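/- Let $p\ge q\ge 1$ be integers. The partitioning orbitope $\mathrm{O}^{=}_{p,q}\subseteq\mathbb{R}^{p\times q}$ is the convex hull of all $0/1$-matrices of size $p\times q$ that have exactly one $1$-entry in each row and whose columns, read from top to bottom, are in lexicographically decreasing (i.e. non-increasing) order from left to right. Linear optimization over $\mathrm{O}^{=}_{p,q}$ can be solved in time $O(pq)$: there are a single program and a constant $C$ such that for all $p\ge q\ge 1$ and every objective vector $d\in\mathbb{R}^{p\times q}$ the program, given $p$, $q$ and $d$, computes an optimal solution $x^\star\in\mathrm{O}^{=}_{p,q}$ of $$\max\Big\{\sum_{i=1}^{p}\sum_{j=1}^{q}d_{ij}x_{ij}\;:\;x\in\mathrm{O}^{=}_{p,q}\Big\}$$ in at most $C\,pq$ steps. Steps are counted on a unit-cost random access machine, on which each memory access, each addition, (truncated) subtraction or comparison of natural numbers, and each addition, subtraction or comparison of real numbers takes one step. -/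

import Mathlib

/-! ### The partitioning orbitope -/

/-- The vertices of the partitioning orbitope: 0/1-matrices of size `p × q` with exactly one
1-entry in every row whose columns, read from top to bottom, are in lexicographically decreasing
(that is, non-increasing) order from left to right. -/
def orbitopeMatrices (p q : ℕ) : Set (Matrix (Fin p) (Fin q) ℝ) :=
  {X | (∀ i j, X i j = 0 ∨ X i j = 1) ∧ (∀ i, ∃! j, X i j = 1) ∧
    Antitone fun j : Fin q => toLex fun i : Fin p => X i j}

/-- The partitioning orbitope: the convex hull of the matrices above. -/
def partitioningOrbitope (p q : ℕ) : Set (Matrix (Fin p) (Fin q) ℝ) :=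
  convexHull ℝ (orbitopeMatrices p q)

/-- The linear objective function `x ↦ ⟨d, x⟩ = ∑ᵢⱼ dᵢⱼ xᵢⱼ`. -/
def objective {p q : ℕ} (d x : Matrix (Fin p) (Fin q) ℝ) : ℝ :=
  ∑ i, ∑ j, d i j * x i j

/-! ### Random access machine programs with a step count

A program is a finite text over scalar variables and one-dimensional arrays, which hold natural
numbers (used as counters and addresses) or exact real numbers (the data).
Variable and array names are constants in the program text, so a
program uses only finitely many of them; array positions are computed at run time.
Natural numbers admit addition, truncated subtraction and comparison; real numbers admit addition,
subtraction and comparison, and a real number is never converted into a natural number.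
Every constant, variable access, array access, arithmetic operation, comparison and assignment
that is carried out costs one step. -/

namespace RealRAM

/-- Memory contents. -/
structure State where
  /-- scalar variables for natural numbers -/
  natVar : ℕ → ℕ
  /-- scalar variables for real numbers -/
  realVar : ℕ → ℝ
  /-- arrays of natural numbers: array name, then position -/
  natArr : ℕ → ℕ → ℕ
  /-- arrays of real numbers: array name, then position -/
  realArr : ℕ → ℕ → ℝ

/-- Expressions with values in the natural numbers. -/
inductive NatExpr where
  | const (k : ℕ)
  | var (v : ℕ)
  | read (a : ℕ) (pos : NatExpr)
  | add (e₁ e₂ : NatExpr)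
  | sub (e₁ e₂ : NatExpr)

/-- Expressions with values in the real numbers. -/
inductive RealExpr where
  | const (k : ℤ)
  | var (v : ℕ)
  | read (a : ℕ) (pos : NatExpr)
  | add (e₁ e₂ : RealExpr)
  | sub (e₁ e₂ : RealExpr)

/-- Comparisons. -/
inductive Test where
  | natLt (e₁ e₂ : NatExpr)
  | realLt (e₁ e₂ : RealExpr)

/-- Programs. -/
inductive Program where
  | skip
  | setNat (v : ℕ) (e : NatExpr)
  | setReal (v : ℕ) (e : RealExpr)
  | writeNat (a : ℕ) (pos : NatExpr) (e : NatExpr)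
  | writeReal (a : ℕ) (pos : NatExpr) (e : RealExpr)
  | seq (P₁ P₂ : Program)
  | branch (b : Test) (P₁ P₂ : Program)
  | loop (b : Test) (P : Program)

/-- The value of an expression. -/
def NatExpr.eval (s : State) : NatExpr → ℕ
  | .const k => k
  | .var v => s.natVar v
  | .read a pos => s.natArr a (pos.eval s)
  | .add e₁ e₂ => e₁.eval s + e₂.eval s
  | .sub e₁ e₂ => e₁.eval s - e₂.eval s

/-- The number of steps to evaluate an expression: one for each of its nodes. -/
def NatExpr.cost : NatExpr → ℕ
  | .const _ => 1
  | .var _ => 1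
  | .read _ pos => pos.cost + 1
  | .add e₁ e₂ => e₁.cost + e₂.cost + 1
  | .sub e₁ e₂ => e₁.cost + e₂.cost + 1

/-- The value of an expression. -/
noncomputable def RealExpr.eval (s : State) : RealExpr → ℝ
  | .const k => (k : ℝ)
  | .var v => s.realVar v
  | .read a pos => s.realArr a (pos.eval s)
  | .add e₁ e₂ => e₁.eval s + e₂.eval s
  | .sub e₁ e₂ => e₁.eval s - e₂.eval s

/-- The number of steps to evaluate an expression: one for each of its nodes. -/
def RealExpr.cost : RealExpr → ℕ
  | .const _ => 1
  | .var _ => 1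
  | .read _ pos => pos.cost + 1
  | .add e₁ e₂ => e₁.cost + e₂.cost + 1
  | .sub e₁ e₂ => e₁.cost + e₂.cost + 1

/-- The outcome of a comparison. -/
def Test.Holds (s : State) : Test → Prop
  | .natLt e₁ e₂ => e₁.eval s < e₂.eval s
  | .realLt e₁ e₂ => e₁.eval s < e₂.eval s

/-- The number of steps of a comparison. -/
def Test.cost : Test → ℕ
  | .natLt e₁ e₂ => e₁.cost + e₂.cost + 1
  | .realLt e₁ e₂ => e₁.cost + e₂.cost + 1

/-- `Exec P s T s'`: started in memory `s`, the program `P` halts after exactly `T` steps, and the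
memory is then `s'`. -/
inductive Exec : Program → State → ℕ → State → Prop where
  | skip (s : State) : Exec .skip s 1 s
  | setNat (s : State) (v : ℕ) (e : NatExpr) :
      Exec (.setNat v e) s (e.cost + 1)
        { s with natVar := Function.update s.natVar v (e.eval s) }
  | setReal (s : State) (v : ℕ) (e : RealExpr) :
      Exec (.setReal v e) s (e.cost + 1)
        { s with realVar := Function.update s.realVar v (e.eval s) }
  | writeNat (s : State) (a : ℕ) (pos : NatExpr) (e : NatExpr) :
      Exec (.writeNat a pos e) s (pos.cost + e.cost + 1)
        { s with natArr := Function.update s.natArr a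
                   (Function.update (s.natArr a) (pos.eval s) (e.eval s)) }
  | writeReal (s : State) (a : ℕ) (pos : NatExpr) (e : RealExpr) :
      Exec (.writeReal a pos e) s (pos.cost + e.cost + 1)
        { s with realArr := Function.update s.realArr a
                   (Function.update (s.realArr a) (pos.eval s) (e.eval s)) }
  | seq {P₁ P₂ : Program} {s s' s'' : State} {T₁ T₂ : ℕ} :
      Exec P₁ s T₁ s' → Exec P₂ s' T₂ s'' → Exec (.seq P₁ P₂) s (T₁ + T₂) s''
  | branchTrue {b : Test} {P₁ P₂ : Program} {s s' : State} {T : ℕ} :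
      b.Holds s → Exec P₁ s T s' → Exec (.branch b P₁ P₂) s (b.cost + T) s'
  | branchFalse {b : Test} {P₁ P₂ : Program} {s s' : State} {T : ℕ} :
      ¬ b.Holds s → Exec P₂ s T s' → Exec (.branch b P₁ P₂) s (b.cost + T) s'
  | loopStop {b : Test} {P : Program} {s : State} :
      ¬ b.Holds s → Exec (.loop b P) s b.cost s
  | loopStep {b : Test} {P : Program} {s s' s'' : State} {T₁ T₂ : ℕ} :
      b.Holds s → Exec P s T₁ s' → Exec (.loop b P) s' T₂ s'' →
        Exec (.loop b P) s (b.cost + T₁ + T₂) s''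

/-- Execution is deterministic: the running time and the final memory are determined by the
program and the initial memory. -/
theorem Exec.unique {P : Program} {s s₁ s₂ : State} {T₁ T₂ : ℕ}
    (h₁ : Exec P s T₁ s₁) (h₂ : Exec P s T₂ s₂) : T₁ = T₂ ∧ s₁ = s₂ := by
  induction h₁ generalizing T₂ s₂ with
  | skip s => cases h₂; exact ⟨rfl, rfl⟩
  | setNat s v e => cases h₂; exact ⟨rfl, rfl⟩
  | setReal s v e => cases h₂; exact ⟨rfl, rfl⟩
  | writeNat s a pos e => cases h₂; exact ⟨rfl, rfl⟩
  | writeReal s a pos e => cases h₂; exact ⟨rfl, rfl⟩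
  | seq _ _ ih₁ ih₂ =>
    cases h₂ with
    | seq k₁ k₂ =>
      obtain ⟨rfl, rfl⟩ := ih₁ k₁
      obtain ⟨rfl, rfl⟩ := ih₂ k₂
      exact ⟨rfl, rfl⟩
  | branchTrue hb _ ih =>
    cases h₂ with
    | branchTrue _ k => obtain ⟨rfl, rfl⟩ := ih k; exact ⟨rfl, rfl⟩
    | branchFalse hb' _ => exact absurd hb hb'
  | branchFalse hb _ ih =>
    cases h₂ with
    | branchTrue hb' _ => exact absurd hb' hb
    | branchFalse _ k => obtain ⟨rfl, rfl⟩ := ih k; exact ⟨rfl, rfl⟩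
  | loopStop hb =>
    cases h₂ with
    | loopStop _ => exact ⟨rfl, rfl⟩
    | loopStep hb' _ _ => exact absurd hb' hb
  | loopStep hb _ _ ih₁ ih₂ =>
    cases h₂ with
    | loopStop hb' => exact absurd hb hb'
    | loopStep _ k₁ k₂ =>
      obtain ⟨rfl, rfl⟩ := ih₁ k₁
      obtain ⟨rfl, rfl⟩ := ih₂ k₂
      exact ⟨rfl, rfl⟩

/-- The initial memory for the input `(p, q, d)`: natural variables `0` and `1` hold `p` and `q`,
real array `0` holds the matrix `d` row by row, and everything else is zero. -/
noncomputable def inputState (p q : ℕ) (d : Matrix (Fin p) (Fin q) ℝ) : State where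
  natVar v := if v = 0 then p else if v = 1 then q else 0
  realVar _ := 0
  natArr _ _ := 0
  realArr a k :=
    if h : a = 0 ∧ k / q < p ∧ 0 < q then d ⟨k / q, h.2.1⟩ ⟨k % q, Nat.mod_lt k h.2.2⟩ else 0

/-- The `p × q` matrix read off, row by row, from real array `1`. -/
def outputMatrix (p q : ℕ) (s : State) : Matrix (Fin p) (Fin q) ℝ :=
  fun i j => s.realArr 1 (i.val * q + j.val)

end RealRAM

/-! ### Restricted growth strings -/

/-! A 0/1-matrix with one 1 per row is a map `c` from rows to columns. Its columns are
lexicographically non-increasing exactly when each row uses a column already in use or the first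
unused one, that is, when `c` is a restricted growth string (`IsGrowth.toMatrix_mem`,
`exists_isGrowth_of_mem`). A linear function that is bounded on the generators of a convex hull has
the same bound on the hull, so it suffices to maximize `∑ D i (c i)` over such strings.

The only information about earlier rows that constrains later ones is the number `m` of columns in
use. Let `V i m` be the best value of rows `i, …, p - 1` in that situation. Then `V i m` is the
larger of `max_{j < m} D i j + V (i + 1) m` (for `0 < m`) and `D i m + V (i + 1) (m + 1)` (for `m <
q`), with `V p m = 0`. Keeping a running prefix maximum of the row while `m` increases makes every
entry cost constant time, so the table takes `O(pq)` steps. Following the stored choices from `m =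
0` takes `O(p)` more (`IsValueTable.isMaxOn`).

The machine has no multiplication, so addresses `i * q` are maintained by additions and
subtractions. One array of values suffices: entry `m` depends only on the old entries `m` and `m +
1`, which are still intact when `m` increases. -/

namespace RestrictedGrowth

/-- The number of columns `0, …, m - 1` needed to hold the values `c 0, …, c (i - 1)`. -/
def numUsed (c : ℕ → ℕ) : ℕ → ℕ
  | 0 => 0
  | i + 1 => max (numUsed c i) (c i + 1)

/-- `c` maps the first `p` rows to columns below `q`, and each row uses a column that is already
in use or the first unused one. -/
def IsGrowth (p q : ℕ) (c : ℕ → ℕ) : Prop :=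
  ∀ i < p, c i < q ∧ c i ≤ numUsed c i

/-- The 0/1-matrix with the 1-entry of row `i` in column `c i`. -/
def toMatrix (p q : ℕ) (c : ℕ → ℕ) : Matrix (Fin p) (Fin q) ℝ :=
  fun i j => if j.val = c i then 1 else 0

theorem lt_numUsed {c : ℕ → ℕ} {i k : ℕ} (h : k < i) : c k < numUsed c i := by
  induction i with
  | zero => omega
  | succ i ih =>
    rcases Nat.lt_succ_iff_lt_or_eq.mp h with h | rfl
    · exact lt_of_lt_of_le (ih h) (le_max_left _ _)
    · exact lt_of_lt_of_le (Nat.lt_succ_self _) (le_max_right _ _)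

/-- The count grows only when the first unused column is opened, so the columns in use have no gaps.
-/
theorem IsGrowth.exists_eq {p q : ℕ} {c : ℕ → ℕ} (hc : IsGrowth p q c) {i : ℕ} (hi : i ≤ p)
    {j : ℕ} (hj : j < numUsed c i) : ∃ k < i, c k = j := by
  induction i with
  | zero => simp [numUsed] at hj
  | succ i ih =>
    by_cases h : j < numUsed c i
    · obtain ⟨k, hk, rfl⟩ := ih (by omega) h
      exact ⟨k, by omega, rfl⟩
    · refine ⟨i, by omega, ?_⟩
      have := (hc i (by omega)).2
      simp only [numUsed, lt_max_iff] at hj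
      omega

theorem numUsed_le {q : ℕ} {c : ℕ → ℕ} {i : ℕ} (h : ∀ k < i, c k < q) : numUsed c i ≤ q := by
  induction i with
  | zero => simp [numUsed]
  | succ i ih =>
    exact max_le (ih fun k hk => h k (by omega)) (h i (by omega))

/-- For columns `j < j'` with `j'` in use, look at the first row that uses either of them. It must
use `j`, since opening `j'` requires `j` to be in use already; this row decides the comparison in
favour of `j`. If `j'` is never used, its column is zero and the comparison is entrywise. -/
theorem IsGrowth.toMatrix_mem {p q : ℕ} {c : ℕ → ℕ} (hc : IsGrowth p q c) :
    toMatrix p q c ∈ orbitopeMatrices p q := by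
  refine ⟨fun i j => ?_, fun i => ?_, ?_⟩
  · unfold toMatrix; split_ifs <;> simp
  · refine ⟨⟨c i, (hc i i.2).1⟩, by simp [toMatrix], fun j hj => ?_⟩
    ext
    by_contra h
    simp [toMatrix, h] at hj
  · intro j j' hjj'
    rcases hjj'.eq_or_lt with rfl | hlt
    · exact le_rfl
    by_cases hex : ∃ k < p, c k = j'.val
    · obtain ⟨i, hi, hij⟩ := hex
      have h1 := (hc i hi).2
      have hlt' : j.val < j'.val := hlt
      have hex : ∃ k, c k = j.val ∧ k < i := by
        obtain ⟨k, hk, hkj⟩ := hc.exists_eq hi.le (j := j.val) (by omega)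
        exact ⟨k, hkj, hk⟩
      have hleast : ∃ k, c k = j.val ∧ k < i ∧ ∀ l < k, c l ≠ j.val ∧ c l ≠ j'.val := by
        have hex' : ∃ k, c k = j.val ∨ c k = j'.val := hex.imp fun k hk => Or.inl hk.1
        classical
        have hmin : ∀ l < Nat.find hex', c l ≠ j.val ∧ c l ≠ j'.val := fun l hl => by
          simpa using Nat.find_min hex' hl
        obtain ⟨k, hkj, hk⟩ := hex
        have hle : Nat.find hex' ≤ k := Nat.find_min' hex' (Or.inl hkj)
        refine ⟨Nat.find hex', ?_, by omega, hmin⟩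
        rcases Nat.find_spec hex' with h | h
        · exact h
        · have h2 := (hc (Nat.find hex') (by omega)).2
          obtain ⟨l, hl, hlj⟩ := hc.exists_eq (i := Nat.find hex') (by omega) (j := j.val)
            (by omega)
          exact absurd hlj (hmin l hl).1
      obtain ⟨k, hkj, hki, hmin⟩ := hleast
      refine le_of_lt ⟨⟨k, by omega⟩, fun l hl => ?_, ?_⟩
      · have := hmin l hl
        simp [toMatrix, this.1.symm, this.2.symm]
      · have : j'.val ≠ j.val := by omega
        simp [toMatrix, this, hkj]
    · push Not at hex
      refine Pi.toLex_monotone fun i => ?_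
      have := (hex i i.2).symm
      simp only [toMatrix, this, if_false]
      split_ifs <;> norm_num

/-- If row `i` skipped an unused column, then columns `c i - 1` and `c i` would both vanish above
row `i`, and row `i` would make the right one lexicographically larger. -/
theorem exists_isGrowth_of_mem {p q : ℕ} {X : Matrix (Fin p) (Fin q) ℝ}
    (hX : X ∈ orbitopeMatrices p q) : ∃ c, IsGrowth p q c ∧ X = toMatrix p q c := by
  obtain ⟨h01, huniq, hanti⟩ := hX
  choose g hg hguniq using fun i => huniq i
  set c : ℕ → ℕ := fun i => if h : i < p then (g ⟨i, h⟩).val else 0 with hcdef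
  have hc : ∀ i : Fin p, c i = (g i).val := fun i => by simp [hcdef]
  have hXc : X = toMatrix p q c := by
    ext i j
    unfold toMatrix
    rw [hc]
    split_ifs with h
    · rw [Fin.ext h, hg]
    · refine (h01 i j).resolve_right fun h1 => h ?_
      rw [hguniq i j h1]
  refine ⟨c, fun i hi => ⟨?_, ?_⟩, hXc⟩
  · rw [hc ⟨i, hi⟩]; exact (g _).2
  · by_contra! hlt
    have hq : c i < q := by rw [hc ⟨i, hi⟩]; exact (g _).2
    have hle := hanti (show (⟨c i - 1, by omega⟩ : Fin q) ≤ ⟨c i, hq⟩ from Nat.sub_le _ _)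
    refine absurd hle (not_le_of_gt ⟨⟨i, hi⟩, fun l hl => ?_, ?_⟩)
    · have := lt_numUsed (c := c) (show l.val < i from hl)
      have h1 : c i - 1 ≠ c l := by omega
      have h2 : c i ≠ c l := by omega
      simp [hXc, toMatrix, h1, h2]
    · have h1 : c i - 1 ≠ c i := by omega
      simp [hXc, toMatrix, h1]

/-! ### Linear objectives on growth strings and on the convex hull -/

theorem objective_toMatrix {p q : ℕ} {c : ℕ → ℕ} (hc : IsGrowth p q c)
    {d : Matrix (Fin p) (Fin q) ℝ} {D : ℕ → ℕ → ℝ}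
    (hD : ∀ (i : Fin p) (j : Fin q), D i j = d i j) :
    objective d (toMatrix p q c) = ∑ i ∈ Finset.range p, D i (c i) := by
  rw [← Fin.sum_univ_eq_sum_range (fun i => D i (c i))]
  refine Finset.sum_congr rfl fun i _ => ?_
  have hlt := (hc i i.2).1
  rw [Finset.sum_eq_single (⟨c i, hlt⟩ : Fin q)]
  · simp [toMatrix, ← hD]
  · intro j _ hj
    have : j.val ≠ c i := fun h => hj (Fin.ext h)
    simp [toMatrix, this]
  · simp

theorem isMaxOn_partitioningOrbitope {p q : ℕ} {d x : Matrix (Fin p) (Fin q) ℝ}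
    (h : ∀ y ∈ orbitopeMatrices p q, objective d y ≤ objective d x) :
    IsMaxOn (objective d) (partitioningOrbitope p q) x := by
  have hlin : IsLinearMap ℝ (objective d) :=
    ⟨fun x y => by simp [objective, mul_add, Finset.sum_add_distrib],
     fun a x => by simp [objective, Finset.mul_sum, mul_left_comm]⟩
  -- The half-space of points with objective value at most that of `x` is convex and contains the
  -- generators.
  exact fun y hy => convexHull_min h (convex_halfSpace_le hlin _) hy

/-! ### Dynamic programming -/

/-- With objective row `f` and values `F` of the remaining rows, column `j` is an optimal choice
of value `v` for the current row when `m` columns are in use. -/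
def IsBestChoice (q : ℕ) (f F : ℕ → ℝ) (m : ℕ) (v : ℝ) (j : ℕ) : Prop :=
  j < q ∧ j ≤ m ∧ v = f j + F (max m (j + 1)) ∧
    ∀ k < q, k ≤ m → f k + F (max m (k + 1)) ≤ v

/-- The values `V i m` of the rows `i, …, p - 1` when `m` columns are in use, with optimal
choices `ch i m` for row `i`, are correct from row `a` on. -/
def IsValueTable (p q : ℕ) (D V : ℕ → ℕ → ℝ) (ch : ℕ → ℕ → ℕ) (a : ℕ) : Prop :=
  (∀ m, V p m = 0) ∧
    ∀ i, a ≤ i → i < p → ∀ m ≤ q, IsBestChoice q (D i) (V (i + 1)) m (V i m) (ch i m)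

/-- The number of columns in use before row `i` when the choices `ch` are followed. -/
def traceUsed (ch : ℕ → ℕ → ℕ) : ℕ → ℕ
  | 0 => 0
  | i + 1 => max (traceUsed ch i) (ch i (traceUsed ch i) + 1)

/-- The column of row `i` when the choices `ch` are followed. -/
def trace (ch : ℕ → ℕ → ℕ) (i : ℕ) : ℕ := ch i (traceUsed ch i)

theorem numUsed_trace (ch : ℕ → ℕ → ℕ) (i : ℕ) : numUsed (trace ch) i = traceUsed ch i := by
  induction i with
  | zero => rfl
  | succ i ih => simp [numUsed, traceUsed, ih, trace]

section IsValueTable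
variable {p q : ℕ} {D V : ℕ → ℕ → ℝ} {ch : ℕ → ℕ → ℕ}

theorem IsValueTable.traceUsed_le (h : IsValueTable p q D V ch 0) {i : ℕ} (hi : i ≤ p) :
    traceUsed ch i ≤ q := by
  induction i with
  | zero => simp [traceUsed]
  | succ i ih =>
    have h1 := ih (by omega)
    exact max_le h1 (h.2 i (by omega) hi _ h1).1

theorem IsValueTable.isGrowth_trace (h : IsValueTable p q D V ch 0) :
    IsGrowth p q (trace ch) := fun i hi => by
  have h1 := h.2 i (by omega) hi _ (h.traceUsed_le hi.le)
  rw [numUsed_trace]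
  exact ⟨h1.1, h1.2.1⟩

/-- Along the traced choices, the value collected so far plus the table value of the remaining rows
is constant. -/
theorem IsValueTable.sum_trace (h : IsValueTable p q D V ch 0) :
    ∑ i ∈ Finset.range p, D i (trace ch i) = V 0 0 := by
  have key : ∀ i ≤ p,
      ∑ k ∈ Finset.range i, D k (trace ch k) + V i (traceUsed ch i) = V 0 0 := by
    intro i
    induction i with
    | zero => simp [traceUsed]
    | succ i ih =>
      intro hi
      have h1 := (h.2 i (by omega) hi (traceUsed ch i) (h.traceUsed_le (by omega))).2.2.1
      rw [← ih (by omega), Finset.sum_range_succ, h1, add_assoc]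
      rfl
  simpa [h.1] using key p le_rfl

/-- Along an arbitrary growth string the same quantity never increases. -/
theorem IsValueTable.sum_le (h : IsValueTable p q D V ch 0) {c : ℕ → ℕ} (hc : IsGrowth p q c) :
    ∑ i ∈ Finset.range p, D i (c i) ≤ V 0 0 := by
  have key : ∀ i ≤ p, ∑ k ∈ Finset.range i, D k (c k) + V i (numUsed c i) ≤ V 0 0 := by
    intro i
    induction i with
    | zero => simp [numUsed]
    | succ i ih =>
      intro hi
      have hq : numUsed c i ≤ q := numUsed_le fun k hk => (hc k (by omega)).1
      have h1 := (h.2 i (by omega) hi _ hq).2.2.2 (c i) (hc i hi).1 (hc i hi).2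
      have := ih (by omega)
      rw [Finset.sum_range_succ]
      simp only [numUsed]
      linarith
  simpa [h.1] using key p le_rfl

theorem IsValueTable.isMaxOn (h : IsValueTable p q D V ch 0)
    {d : Matrix (Fin p) (Fin q) ℝ} (hD : ∀ (i : Fin p) (j : Fin q), D i j = d i j) :
    IsMaxOn (objective d) (partitioningOrbitope p q) (toMatrix p q (trace ch)) := by
  refine isMaxOn_partitioningOrbitope fun y hy => ?_
  obtain ⟨c, hc, rfl⟩ := exists_isGrowth_of_mem hy
  rw [objective_toMatrix hc hD, objective_toMatrix h.isGrowth_trace hD, h.sum_trace]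
  exact h.sum_le hc

end IsValueTable

/-- Optimal choices for a row can be read off from the maximum of `f` over the columns in use. -/
theorem IsBestChoice.of_prefix_max {q : ℕ} {f F : ℕ → ℝ} {m a : ℕ} (hm : 0 < m) (hmq : m ≤ q)
    (ha : a < m) (hmax : ∀ k < m, f k ≤ f a) (hnew : m < q → f m + F (m + 1) ≤ f a + F m) :
    IsBestChoice q f F m (f a + F m) a := by
  refine ⟨by omega, by omega, by rw [max_eq_left (by omega)], fun k hk hkm => ?_⟩
  rcases hkm.eq_or_lt with rfl | hlt
  · simpa using hnew hk
  · rw [max_eq_left (by omega)]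
    linarith [hmax k hlt]

/-- For `m = 0` no old column competes: both conditions on `a` are vacuous, and opening column `0`
is forced. -/
theorem IsBestChoice.of_new_column {q : ℕ} {f F : ℕ → ℝ} {m a : ℕ} (hmq : m < q)
    (hmax : ∀ k < m, f k ≤ f a) (hnew : 0 < m → f a + F m ≤ f m + F (m + 1)) :
    IsBestChoice q f F m (f m + F (m + 1)) m := by
  refine ⟨hmq, le_rfl, by simp, fun k hk hkm => ?_⟩
  rcases hkm.eq_or_lt with rfl | hlt
  · simp
  · rw [max_eq_left (by omega)]
    linarith [hmax k hlt, hnew (by omega)]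

end RestrictedGrowth

/-! ### Verification of programs -/

namespace RealRAM

/-- Started in `s`, the program halts after a number of steps and in a memory that satisfy `Q`. -/
def Halts (P : Program) (s : State) (Q : ℕ → State → Prop) : Prop :=
  ∃ T s', Exec P s T s' ∧ Q T s'

theorem Halts.mono {P : Program} {s : State} {Q Q' : ℕ → State → Prop} (h : Halts P s Q)
    (hQ : ∀ T s', Q T s' → Q' T s') : Halts P s Q' :=
  let ⟨T, s', he, hq⟩ := h
  ⟨T, s', he, hQ T s' hq⟩

theorem halts_skip {s : State} {Q : ℕ → State → Prop} (h : Q 1 s) : Halts .skip s Q :=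
  ⟨_, _, .skip s, h⟩

theorem halts_setNat {s : State} {v : ℕ} {e : NatExpr} {Q : ℕ → State → Prop}
    (h : Q (e.cost + 1) { s with natVar := Function.update s.natVar v (e.eval s) }) :
    Halts (.setNat v e) s Q :=
  ⟨_, _, .setNat s v e, h⟩

theorem halts_writeNat {s : State} {a : ℕ} {pos e : NatExpr} {Q : ℕ → State → Prop}
    (h : Q (pos.cost + e.cost + 1)
      { s with natArr := Function.update s.natArr a
                 (Function.update (s.natArr a) (pos.eval s) (e.eval s)) }) :
    Halts (.writeNat a pos e) s Q :=
  ⟨_, _, .writeNat s a pos e, h⟩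

theorem halts_writeReal {s : State} {a : ℕ} {pos : NatExpr} {e : RealExpr}
    {Q : ℕ → State → Prop}
    (h : Q (pos.cost + e.cost + 1)
      { s with realArr := Function.update s.realArr a
                 (Function.update (s.realArr a) (pos.eval s) (e.eval s)) }) :
    Halts (.writeReal a pos e) s Q :=
  ⟨_, _, .writeReal s a pos e, h⟩

/-- The steps already spent enter the postcondition of the second program, so these rules compose by
backward application, without naming intermediate memories. -/
theorem halts_seq {P₁ P₂ : Program} {s : State} {Q : ℕ → State → Prop}
    (h : Halts P₁ s fun T₁ s' => Halts P₂ s' fun T₂ s'' => Q (T₁ + T₂) s'') :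
    Halts (.seq P₁ P₂) s Q :=
  let ⟨_, _, he₁, _, _, he₂, hq⟩ := h
  ⟨_, _, .seq he₁ he₂, hq⟩

theorem halts_branch {b : Test} {P₁ P₂ : Program} {s : State} {Q : ℕ → State → Prop}
    (h₁ : b.Holds s → Halts P₁ s fun T s' => Q (b.cost + T) s')
    (h₂ : ¬ b.Holds s → Halts P₂ s fun T s' => Q (b.cost + T) s') :
    Halts (.branch b P₁ P₂) s Q := by
  by_cases hb : b.Holds s
  · obtain ⟨T, s', he, hq⟩ := h₁ hb
    exact ⟨_, _, .branchTrue hb he, hq⟩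
  · obtain ⟨T, s', he, hq⟩ := h₂ hb
    exact ⟨_, _, .branchFalse hb he, hq⟩

/-- A loop with invariant `I k` before the `k`-th of `n` rounds of at most `K` steps each. -/
theorem halts_loop {b : Test} {P : Program} {s : State} (I : ℕ → State → Prop) (n K : ℕ)
    (hstart : I 0 s)
    (hstep : ∀ k < n, ∀ s, I k s → b.Holds s ∧ Halts P s fun T s' => T ≤ K ∧ I (k + 1) s')
    (hexit : ∀ s, I n s → ¬ b.Holds s) :
    Halts (.loop b P) s fun T s' => T ≤ n * (K + b.cost) + b.cost ∧ I n s' := by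
  -- Induction on the number `r` of rounds still to come, since the step bound counts those.
  have key : ∀ r k, k + r = n → ∀ s, I k s →
      Halts (.loop b P) s fun T s' => T ≤ r * (K + b.cost) + b.cost ∧ I n s' := by
    intro r
    induction r with
    | zero =>
      rintro k rfl s hs
      exact ⟨_, _, .loopStop (hexit s hs), by omega, hs⟩
    | succ r ih =>
      intro k hk s hs
      obtain ⟨hb, T₁, s₁, he₁, hT₁, hs₁⟩ := hstep k (by omega) s hs
      obtain ⟨T₂, s₂, he₂, hT₂, hs₂⟩ := ih (k + 1) (by omega) s₁ hs₁
      refine ⟨_, _, .loopStep hb he₁ he₂, ?_, hs₂⟩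
      rw [Nat.succ_mul]
      omega
  exact key n 0 (by omega) s hstart

end RealRAM

/-! ### The program

Natural variables: `0` holds `p`, `1` holds `q`, `2` the row `i`, `3` the product `i * q`, `4` the
number `m` of columns in use, `5` a column. Real array `2` holds the values of the rows after the
current one by the number of columns in use, and position `i * q + i + m` of natural array `0` the
best column for row `i` when `m` columns are in use. -/

namespace RealRAM

open RestrictedGrowth

/-- Computes `p * q`. -/
def sizeLoop : Program :=
  .loop (.natLt (.var 2) (.var 0))
    (.seq (.setNat 3 (.add (.var 3) (.var 1))) (.setNat 2 (.add (.var 2) (.const 1))))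

/-- The position of `(i, m)` in the table of choices. -/
def choicePos : NatExpr := .add (.add (.var 3) (.var 2)) (.var 4)

/-- Stores the value and choice that open column `m`. -/
def chooseNew : Program :=
  .seq (.writeReal 2 (.var 4)
      (.add (.read 0 (.add (.var 3) (.var 4))) (.read 2 (.add (.var 4) (.const 1)))))
    (.writeNat 0 choicePos (.var 4))

/-- Stores the value and choice that use the best of the first `m` columns. -/
def chooseOld : Program :=
  .seq (.writeReal 2 (.var 4) (.add (.read 0 (.add (.var 3) (.var 5))) (.read 2 (.var 4))))
    (.writeNat 0 choicePos (.var 5))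

/-- One entry of the table of values, for `0 < m < q`. -/
def entryStep : Program :=
  .seq
    (.branch (.realLt (.add (.read 0 (.add (.var 3) (.var 5))) (.read 2 (.var 4)))
        (.add (.read 0 (.add (.var 3) (.var 4))) (.read 2 (.add (.var 4) (.const 1)))))
      chooseNew chooseOld)
    (.seq
      (.branch (.realLt (.read 0 (.add (.var 3) (.var 5))) (.read 0 (.add (.var 3) (.var 4))))
        (.setNat 5 (.var 4)) .skip)
      (.setNat 4 (.add (.var 4) (.const 1))))

/-- One row of the table of values. -/
def rowStep : Program :=
  .seq (.setNat 2 (.sub (.var 2) (.const 1)))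
    (.seq (.setNat 3 (.sub (.var 3) (.var 1)))
      (.seq (.setNat 4 (.const 0))
        (.seq chooseNew
          (.seq (.setNat 5 (.const 0))
            (.seq (.setNat 4 (.const 1))
              (.seq (.loop (.natLt (.var 4) (.var 1)) entryStep) chooseOld))))))

/-- The table of values, from the last row to the first. -/
def tableLoop : Program := .loop (.natLt (.const 0) (.var 2)) rowStep

/-- One row of the output. -/
def outputStep : Program :=
  .seq (.setNat 5 (.read 0 choicePos))
    (.seq (.writeReal 1 (.add (.var 3) (.var 5)) (.const 1))
      (.seq (.branch (.natLt (.var 5) (.var 4)) .skip (.setNat 4 (.add (.var 5) (.const 1))))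
        (.seq (.setNat 3 (.add (.var 3) (.var 1))) (.setNat 2 (.add (.var 2) (.const 1))))))

/-- Follows the choices from the first row to the last. -/
def outputLoop : Program := .loop (.natLt (.var 2) (.var 0)) outputStep

/-- The linear optimization program for the partitioning orbitope. -/
def orbitopeProgram : Program :=
  .seq sizeLoop (.seq tableLoop (.seq (.setNat 4 (.const 0)) outputLoop))

/-- The memory holds the input and the address of row `i`. -/
structure AtRow (p q : ℕ) (D : ℕ → ℕ → ℝ) (i : ℕ) (s : State) : Prop where
  rows : s.natVar 0 = p
  cols : s.natVar 1 = q
  row : s.natVar 2 = i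
  base : s.natVar 3 = i * q
  data : ∀ i j, s.realArr 0 (i * q + j) = D i j

/-! ### Counting pass and table of values -/

theorem halts_sizeLoop {p q : ℕ} {D : ℕ → ℕ → ℝ} {s : State} (hs : AtRow p q D 0 s) :
    Halts sizeLoop s fun T s' => T ≤ p * 11 + 3 ∧ AtRow p q D p s' ∧
      s'.realArr = s.realArr := by
  -- Two assignments of 4 steps make up a round; the test adds 3.
  refine (halts_loop (fun k s' => AtRow p q D k s' ∧ s'.realArr = s.realArr) p 8
    ⟨hs, rfl⟩ ?_ ?_).mono fun T s' h => h
  · rintro k hk s' ⟨h, h2⟩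
    refine ⟨by simpa [Test.Holds, NatExpr.eval, h.row, h.rows] using hk, ?_⟩
    refine halts_seq (halts_setNat (halts_setNat ?_))
    refine ⟨by simp [NatExpr.cost], ⟨?_, ?_, ?_, ?_, ?_⟩, h2⟩ <;>
      simp [NatExpr.eval, h.rows, h.cols, h.row, h.base, h.data, Nat.succ_mul]
  · rintro s' ⟨h, -⟩
    simp [Test.Holds, NatExpr.eval, h.row, h.rows]

/-- The memory while row `i` of the table is computed: the entries below `m` are done, and `a` is
the best of the first `m` columns. -/
structure InRow (p q : ℕ) (D : ℕ → ℕ → ℝ) (i : ℕ) (F : ℕ → ℝ) (s₀ : State) (m : ℕ) (a : ℕ)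
    (s : State) : Prop extends AtRow p q D i s where
  pos : s.natVar 4 = m
  best : s.natVar 5 = a
  best_lt : a < m
  le_best : ∀ k < m, D i k ≤ D i a
  done : ∀ k < m, IsBestChoice q (D i) F k (s.realArr 2 k) (s.natArr 0 (i * q + i + k))
  todo : ∀ k, m ≤ k → s.realArr 2 k = F k
  later : ∀ k, i * q + i + q < k → s.natArr 0 k = s₀.natArr 0 k
  output : s.realArr 1 = s₀.realArr 1

section
variable {p q : ℕ} {D : ℕ → ℕ → ℝ} {i : ℕ} {F : ℕ → ℝ} {s₀ : State}

/-- The memory right after the entry `m` of row `i` is stored. -/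
structure EntryStored (p q : ℕ) (D : ℕ → ℕ → ℝ) (i : ℕ) (F : ℕ → ℝ) (s₀ : State) (m : ℕ)
    (s : State) : Prop extends AtRow p q D i s where
  pos : s.natVar 4 = m
  done : ∀ k ≤ m, IsBestChoice q (D i) F k (s.realArr 2 k) (s.natArr 0 (i * q + i + k))
  todo : ∀ k, m < k → s.realArr 2 k = F k
  later : ∀ k, i * q + i + q < k → s.natArr 0 k = s₀.natArr 0 k
  output : s.realArr 1 = s₀.realArr 1

/-- The common effect of `chooseNew` and `chooseOld`. Row `i` of the choice table has the `q + 1`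
positions `i * q + i + m` with `m ≤ q`, so the write disturbs neither its smaller entries nor any
position beyond `i * q + i + q`. -/
theorem EntryStored.of_write {m j : ℕ} {v : ℝ} {s : State}
    (hs : AtRow p q D i s) (hpos : s.natVar 4 = m) (hmq : m ≤ q)
    (hdone : ∀ k < m, IsBestChoice q (D i) F k (s.realArr 2 k) (s.natArr 0 (i * q + i + k)))
    (htodo : ∀ k, m < k → s.realArr 2 k = F k)
    (hlater : ∀ k, i * q + i + q < k → s.natArr 0 k = s₀.natArr 0 k)
    (hout : s.realArr 1 = s₀.realArr 1)
    (hbest : IsBestChoice q (D i) F m v j) :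
    EntryStored p q D i F s₀ m
      { s with
        natArr := Function.update s.natArr 0 (Function.update (s.natArr 0) (i * q + i + m) j)
        realArr := Function.update s.realArr 2 (Function.update (s.realArr 2) m v) } where
  rows := hs.rows
  cols := hs.cols
  row := hs.row
  base := hs.base
  data := by simpa using hs.data
  pos := hpos
  done k hk := by
    rcases hk.eq_or_lt with rfl | hk
    · simpa using hbest
    · have h2 : i * q + i + k ≠ i * q + i + m := by omega
      simpa [Function.update_of_ne hk.ne, Function.update_of_ne h2] using hdone k hk
  todo k hk := by simpa [Function.update_of_ne hk.ne'] using htodo k hk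
  later k hk := by
    have h2 : k ≠ i * q + i + m := by omega
    simpa [Function.update_of_ne h2] using hlater k hk
  output := by simpa using hout

theorem halts_chooseNew {m : ℕ} {s : State}
    (hs : AtRow p q D i s) (hpos : s.natVar 4 = m) (hmq : m ≤ q)
    (hdone : ∀ k < m, IsBestChoice q (D i) F k (s.realArr 2 k) (s.natArr 0 (i * q + i + k)))
    (htodo : ∀ k, m < k → s.realArr 2 k = F k)
    (hlater : ∀ k, i * q + i + q < k → s.natArr 0 k = s₀.natArr 0 k)
    (hout : s.realArr 1 = s₀.realArr 1)
    (hbest : IsBestChoice q (D i) F m (D i m + F (m + 1)) m) :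
    Halts chooseNew s fun T s' => T ≤ 18 ∧ EntryStored p q D i F s₀ m s' ∧
      s'.natVar = s.natVar := by
  refine halts_seq (halts_writeReal (halts_writeNat
    ⟨by simp [NatExpr.cost, RealExpr.cost, choicePos], ?_, rfl⟩))
  have := EntryStored.of_write hs hpos hmq hdone htodo hlater hout hbest
  simpa [NatExpr.eval, RealExpr.eval, choicePos, hs.base, hs.row, hpos, hs.data,
    htodo (m + 1) (Nat.lt_succ_self m)] using this

theorem halts_chooseOld {m a : ℕ} {s : State} (hmq : m ≤ q)
    (hs : InRow p q D i F s₀ m a s)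
    (hbest : IsBestChoice q (D i) F m (D i a + F m) a) :
    Halts chooseOld s fun T s' => T ≤ 18 ∧ EntryStored p q D i F s₀ m s' ∧
      s'.natVar = s.natVar := by
  refine halts_seq (halts_writeReal (halts_writeNat
    ⟨by simp [NatExpr.cost, RealExpr.cost, choicePos], ?_, rfl⟩))
  have := EntryStored.of_write hs.toAtRow hs.pos hmq hs.done (fun k hk => hs.todo k hk.le)
    hs.later hs.output hbest
  simpa [NatExpr.eval, RealExpr.eval, choicePos, hs.base, hs.row, hs.pos, hs.best, hs.data,
    hs.todo m le_rfl] using this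

/-- Restores the row invariant once column `m` has been taken into the prefix maximum. This must
follow the storing of entry `m`, whose old-column option ranges over columns below `m` only. -/
theorem EntryStored.inRow_succ {m a : ℕ} {s s' : State} (h : EntryStored p q D i F s₀ m s)
    (ha : a < m + 1) (hmax : ∀ k < m + 1, D i k ≤ D i a)
    (hnat : s'.natVar = Function.update (Function.update s.natVar 5 a) 4 (m + 1))
    (hnatArr : s'.natArr = s.natArr) (hrealArr : s'.realArr = s.realArr) :
    InRow p q D i F s₀ (m + 1) a s' where
  rows := by simp [hnat, h.rows]
  cols := by simp [hnat, h.cols]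
  row := by simp [hnat, h.row]
  base := by simp [hnat, h.base]
  data := by simpa [hrealArr] using h.data
  pos := by simp [hnat]
  best := by simp [hnat]
  best_lt := ha
  le_best := hmax
  done k hk := by simpa [hrealArr, hnatArr] using h.done k (by omega)
  todo k hk := by simpa [hrealArr] using h.todo k hk
  later := by simpa [hnatArr] using h.later
  output := by simpa [hrealArr] using h.output

theorem halts_entryStep {m a : ℕ} {s : State} (hmq : m < q)
    (hs : InRow p q D i F s₀ m a s) :
    Halts entryStep s fun T s' => T ≤ 60 ∧ ∃ a', InRow p q D i F s₀ (m + 1) a' s' := by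
  have hstore : Halts (.branch (.realLt (.add (.read 0 (.add (.var 3) (.var 5)))
        (.read 2 (.var 4)))
        (.add (.read 0 (.add (.var 3) (.var 4))) (.read 2 (.add (.var 4) (.const 1)))))
      chooseNew chooseOld) s fun T s' => T ≤ 35 ∧ EntryStored p q D i F s₀ m s' ∧
        s'.natVar = s.natVar := by
    have htest : ((RealExpr.add (.read 0 (.add (.var 3) (.var 5))) (.read 2 (.var 4))).eval s <
        (RealExpr.add (.read 0 (.add (.var 3) (.var 4)))
          (.read 2 (.add (.var 4) (.const 1)))).eval s) ↔
        D i a + F m < D i m + F (m + 1) := by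
      simp [NatExpr.eval, RealExpr.eval, hs.base, hs.pos, hs.best, hs.data, hs.todo m le_rfl,
        hs.todo (m + 1) (Nat.le_succ m)]
    refine halts_branch (fun hb => ?_) (fun hb => ?_)
    · have hb := htest.mp hb
      refine (halts_chooseNew hs.toAtRow hs.pos hmq.le hs.done (fun k hk => hs.todo k hk.le)
        hs.later hs.output (.of_new_column hmq hs.le_best fun _ => hb.le)).mono
        fun T s' h => ⟨?_, h.2⟩
      have := h.1
      simp only [Test.cost, RealExpr.cost, NatExpr.cost]
      omega
    · have hb := not_lt.mp (htest.not.mp hb)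
      refine (halts_chooseOld hmq.le hs (.of_prefix_max (by have := hs.best_lt; omega) hmq.le
        hs.best_lt hs.le_best fun _ => hb)).mono fun T s' h => ⟨?_, h.2⟩
      have := h.1
      simp only [Test.cost, RealExpr.cost, NatExpr.cost]
      omega
  refine halts_seq (hstore.mono fun T₁ s₁ h => ?_)
  obtain ⟨hT₁, h₁, hnat⟩ := h
  have hbest₁ : s₁.natVar 5 = a := by rw [hnat, hs.best]
  have htest : ((RealExpr.read 0 (.add (.var 3) (.var 5))).eval s₁ <
      (RealExpr.read 0 (.add (.var 3) (.var 4))).eval s₁) ↔ D i a < D i m := by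
    simp [NatExpr.eval, RealExpr.eval, h₁.base, h₁.pos, hbest₁, h₁.data]
  refine halts_seq (halts_branch (fun hb => halts_setNat (halts_setNat ⟨?_, m, ?_⟩))
    (fun hb => halts_skip (halts_setNat ⟨?_, a, ?_⟩)))
  · simp only [Test.cost, RealExpr.cost, NatExpr.cost]
    omega
  · have hb := htest.mp hb
    refine h₁.inRow_succ (Nat.lt_succ_self m) (fun k hk => ?_) ?_ rfl rfl
    · rcases Nat.lt_succ_iff_lt_or_eq.mp hk with hk | rfl
      · exact (hs.le_best k hk).trans hb.le
      · exact le_rfl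
    · simp [NatExpr.eval, h₁.pos]
  · simp only [Test.cost, RealExpr.cost, NatExpr.cost]
    omega
  · have hb := not_lt.mp (htest.not.mp hb)
    refine h₁.inRow_succ (hs.best_lt.trans (Nat.lt_succ_self m)) (fun k hk => ?_) ?_ rfl rfl
    · rcases Nat.lt_succ_iff_lt_or_eq.mp hk with hk | rfl
      · exact hs.le_best k hk
      · exact hb
    · simp [NatExpr.eval, h₁.pos, ← hbest₁]

/-- One row of the table of values is computed in `O(q)` steps. -/
theorem halts_rowStep {s : State} (hq : 1 ≤ q) (hs : AtRow p q D (i + 1) s)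
    (hF : ∀ m, s.realArr 2 m = F m) :
    Halts rowStep s fun T s' => T ≤ q * 100 ∧ EntryStored p q D i F s q s' := by
  refine halts_seq (halts_setNat (halts_seq (halts_setNat (halts_seq (halts_setNat
    (halts_seq ?_))))))
  refine Halts.mono (halts_chooseNew (p := p) (q := q) (D := D) (i := i) (F := F) (s₀ := s)
    (m := 0) ⟨?_, ?_, ?_, ?_, hs.data⟩ ?_ (Nat.zero_le _) ?_ (fun k _ => hF k) (fun _ _ => rfl)
    rfl (.of_new_column (a := 0) hq (by simp) (by simp))) fun T₁ s₁ h => ?_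
  · simp [hs.rows]
  · simp [hs.cols]
  · simp [NatExpr.eval, hs.row]
  · simp [NatExpr.eval, hs.base, hs.cols, Nat.succ_mul]
  · simp [NatExpr.eval]
  · simp
  obtain ⟨hT₁, h₁, -⟩ := h
  refine halts_seq (halts_setNat (halts_seq (halts_setNat (halts_seq ?_))))
  -- Round `k` treats entry `m = k + 1`, so `q - 1` rounds cover `0 < m < q`. Initially column `0`
  -- is the maximum of the one-column prefix.
  refine Halts.mono (halts_loop (fun k s' => ∃ a, InRow p q D i F s (k + 1) a s') (q - 1) 60
    ⟨0, h₁.inRow_succ (Nat.lt_succ_self 0) (by simp) rfl rfl rfl⟩ ?_ ?_)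
    fun T₂ s₂ h => ?_
  · rintro k hk s' ⟨a, h⟩
    refine ⟨?_, halts_entryStep (by omega) h⟩
    simp only [Test.Holds, NatExpr.eval, h.pos, h.cols]
    omega
  · rintro s' ⟨a, h⟩
    simp only [Test.Holds, NatExpr.eval, h.pos, h.cols]
    omega
  · obtain ⟨hT₂, a, h₂⟩ := h
    rw [Nat.sub_add_cancel hq] at h₂
    -- At `m = q` no new column exists, so only the old columns compete.
    refine (halts_chooseOld le_rfl h₂ (.of_prefix_max hq le_rfl h₂.best_lt h₂.le_best
      fun h => absurd h (lt_irrefl _))).mono fun T₃ s₃ h => ⟨?_, h.2.1⟩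
    have := h.1
    simp only [Test.cost, NatExpr.cost] at hT₂ ⊢
    omega

/-- The table of values is correct from row `i` on. -/
structure TableFrom (p q : ℕ) (D : ℕ → ℕ → ℝ) (i : ℕ) (s : State) : Prop
    extends AtRow p q D i s where
  output : ∀ k, s.realArr 1 k = 0
  table : ∃ V, IsValueTable p q D V (fun k m => s.natArr 0 (k * q + k + m)) i ∧
    ∀ m, s.realArr 2 m = V i m

theorem EntryStored.tableFrom {s s' : State} (hs : TableFrom p q D (i + 1) s) (hi : i < p)
    (h : EntryStored p q D i (s.realArr 2) s q s') : TableFrom p q D i s' := by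
  obtain ⟨V, hV, hF⟩ := hs.table
  refine ⟨h.toAtRow, fun k => by rw [h.output, hs.output], ?_⟩
  -- The value array now holds row `i`, which is inserted into the mathematical table `V`; the row
  -- it replaced survives only in `V`.
  refine ⟨Function.update V i (s'.realArr 2), ⟨fun m => ?_, fun k hk hkp m hm => ?_⟩, by simp⟩
  · rw [Function.update_of_ne hi.ne', hV.1]
  · have hne : k + 1 ≠ i := by omega
    rw [Function.update_of_ne hne]
    rcases hk.eq_or_lt with rfl | hk
    · have := h.done m hm
      rw [funext hF] at this
      simpa using this
    · rw [Function.update_of_ne hk.ne']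
      -- Choices of a later row `k` lie beyond position `i * q + i + q` and are therefore unchanged.
      have hle : (i + 1) * q ≤ k * q := Nat.mul_le_mul_right q hk
      rw [Nat.succ_mul] at hle
      have := hV.2 k hk hkp m hm
      simpa only [h.later (k * q + k + m) (by omega)] using this

theorem halts_tableLoop {s : State} (hq : 1 ≤ q) (hs : TableFrom p q D p s) :
    Halts tableLoop s fun T s' => T ≤ p * (q * 100 + 3) + 3 ∧ TableFrom p q D 0 s' := by
  refine (halts_loop (fun k s' => TableFrom p q D (p - k) s') p (q * 100) hs ?_ ?_).mono
    fun T s' h => ⟨h.1, by simpa using h.2⟩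
  · intro k hk s' h
    refine ⟨?_, ?_⟩
    · simp only [Test.Holds, NatExpr.eval, h.row]
      omega
    · obtain ⟨i, hi⟩ : ∃ i, p - k = i + 1 := ⟨p - k - 1, by omega⟩
      rw [hi] at h
      rw [show p - (k + 1) = i by omega]
      exact (halts_rowStep hq h.toAtRow fun _ => rfl).mono
        fun T s'' h' => ⟨h'.1, h'.2.tableFrom h (by omega)⟩
  · intro s' h
    simp [Test.Holds, NatExpr.eval, h.row]

/-! ### Following the stored choices -/

/-- The memory when the choices `ch` have been followed through the rows before `i`. -/
structure OutputBefore (p q : ℕ) (D : ℕ → ℕ → ℝ) (ch : ℕ → ℕ → ℕ) (i : ℕ) (s : State) : Prop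
    extends AtRow p q D i s where
  choices : ∀ k m, s.natArr 0 (k * q + k + m) = ch k m
  used : s.natVar 4 = traceUsed ch i
  output : ∀ k, ∀ j < q, s.realArr 1 (k * q + j) = if k < i ∧ j = trace ch k then 1 else 0

theorem halts_outputStep {ch : ℕ → ℕ → ℕ} {s : State} (hch : trace ch i < q)
    (hs : OutputBefore p q D ch i s) :
    Halts outputStep s fun T s' => T ≤ 40 ∧ OutputBefore p q D ch (i + 1) s' := by
  have hcol : choicePos.eval s = i * q + i + traceUsed ch i := by
    simp [choicePos, NatExpr.eval, hs.base, hs.row, hs.used]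
  have hval : s.natArr 0 (choicePos.eval s) = trace ch i := by
    rw [hcol, hs.choices, trace]
  have hout : ∀ k, ∀ j < q,
      Function.update (s.realArr 1) (i * q + trace ch i) 1 (k * q + j) =
        if k < i + 1 ∧ j = trace ch k then (1 : ℝ) else 0 := by
    intro k j hj
    by_cases heq : k * q + j = i * q + trace ch i
    · have hk : k = i := by
        have := congrArg (· / q) heq
        simpa [Nat.mul_comm _ q, Nat.mul_add_div (show 0 < q by omega), Nat.div_eq_of_lt hj,
          Nat.div_eq_of_lt hch] using this
      subst hk
      have hj' : j = trace ch k := by omega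
      simp [hj']
    · rw [Function.update_of_ne heq, hs.output k j hj]
      congr 1
      refine propext ⟨fun h => ⟨by omega, h.2⟩, fun h => ⟨?_, h.2⟩⟩
      rcases Nat.lt_succ_iff_lt_or_eq.mp h.1 with h1 | rfl
      · exact h1
      · exact absurd (by rw [h.2]) heq
  -- Both branches leave `max m (j + 1)` in variable `4`, where `j` is the chosen column: this is
  -- `m` if `j < m`, and `j + 1` otherwise.
  refine halts_seq (halts_setNat (halts_seq (halts_writeReal (halts_seq
    (halts_branch (fun hb => halts_skip ?_) (fun hb => halts_setNat ?_)))))) <;>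
  refine halts_seq (halts_setNat (halts_setNat ⟨by
    simp [Test.cost, NatExpr.cost, RealExpr.cost, choicePos],
    ⟨?_, ?_, ?_, ?_, ?_⟩, ?_, ?_, ?_⟩)) <;>
  simp [Test.Holds, NatExpr.eval, RealExpr.eval, hval, hs.rows, hs.cols, hs.row, hs.base, hs.data,
    Nat.succ_mul, hs.choices, hs.used, traceUsed] at hb ⊢
  · exact hb
  · simpa [Nat.lt_succ_iff] using hout
  · exact (max_eq_right (show traceUsed ch i ≤ trace ch i + 1 by omega)).symm
  · simpa [Nat.lt_succ_iff] using hout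

theorem halts_outputLoop {ch : ℕ → ℕ → ℕ} {s : State} (hch : ∀ i < p, trace ch i < q)
    (hs : OutputBefore p q D ch 0 s) :
    Halts outputLoop s fun T s' => T ≤ p * 43 + 3 ∧ OutputBefore p q D ch p s' := by
  refine halts_loop (OutputBefore p q D ch) p 40 hs ?_ ?_
  · intro k hk s' h
    exact ⟨by simpa [Test.Holds, NatExpr.eval, h.row, h.rows] using hk,
      halts_outputStep (hch k hk) h⟩
  · intro s' h
    simp [Test.Holds, NatExpr.eval, h.row, h.rows]

end

theorem halts_orbitopeProgram {p q : ℕ} (hq : 1 ≤ q) (hp : 1 ≤ p)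
    (d : Matrix (Fin p) (Fin q) ℝ) :
    Halts orbitopeProgram (inputState p q d) fun T s =>
      T ≤ 200 * (p * q) ∧ outputMatrix p q s ∈ partitioningOrbitope p q ∧
        IsMaxOn (objective d) (partitioningOrbitope p q) (outputMatrix p q s) := by
  -- Extending `d` to all indices by reading the input array makes the memory invariant `data` hold
  -- by definition; for `j ≥ q` the address may run into later rows, but only columns below `q`
  -- matter.
  set D : ℕ → ℕ → ℝ := fun i j => (inputState p q d).realArr 0 (i * q + j) with hDdef
  have hD : ∀ (i : Fin p) (j : Fin q), D i j = d i j := by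
    intro i j
    have hdiv : (i.val * q + j.val) / q = i := by
      rw [Nat.mul_comm, Nat.mul_add_div hq, Nat.div_eq_of_lt j.2, add_zero]
    have hmod : (i.val * q + j.val) % q = j := by
      rw [Nat.mul_comm, Nat.mul_add_mod, Nat.mod_eq_of_lt j.2]
    have : 0 < q := hq
    simp only [hDdef, inputState, hdiv, true_and]
    rw [dif_pos ⟨i.2, this⟩]
    exact congrArg (d i) (Fin.ext hmod)
  have hstart : AtRow p q D 0 (inputState p q d) :=
    ⟨by simp [inputState], by simp [inputState], by simp [inputState], by simp [inputState],
      fun i j => rfl⟩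
  refine halts_seq ((halts_sizeLoop hstart).mono fun T₁ s₁ h => ?_)
  obtain ⟨hT₁, h₁, hmem⟩ := h
  have htab : TableFrom p q D p s₁ := by
    -- From row `p` on there is nothing to choose: the zero table is correct, and the untouched
    -- value array holds it.
    refine ⟨h₁, fun k => by simp [hmem, inputState], fun _ _ => 0, ⟨fun _ => rfl, ?_⟩, ?_⟩
    · intro i hi hip
      omega
    · simp [hmem, inputState]
  refine halts_seq ((halts_tableLoop hq htab).mono fun T₂ s₂ h => ?_)
  obtain ⟨hT₂, h₂⟩ := h
  obtain ⟨V, hV, -⟩ := h₂.table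
  refine halts_seq (halts_setNat (Halts.mono (halts_outputLoop (p := p) (q := q) (D := D)
    (fun i hi => (hV.isGrowth_trace i hi).1) ⟨⟨?_, ?_, ?_, ?_, h₂.data⟩, ?_, ?_, ?_⟩)
      fun T₃ s₃ h => ?_))
  · simp [h₂.rows]
  · simp [h₂.cols]
  · simp [h₂.row]
  · simp [h₂.base]
  · intro k m; rfl
  · simp [NatExpr.eval, traceUsed]
  · simp [h₂.output]
  obtain ⟨hT₃, h₃⟩ := h
  have hX : outputMatrix p q s₃ = toMatrix p q (trace fun k m => s₂.natArr 0 (k * q + k + m)) := by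
    ext i j
    simp [outputMatrix, toMatrix, h₃.output i j j.2]
  refine ⟨?_, ?_, ?_⟩
  · have h1 : p ≤ p * q := Nat.le_mul_of_pos_right p hq
    have h2 : p * (q * 100 + 3) = 100 * (p * q) + 3 * p := by ring
    rw [h2] at hT₂
    simp only [NatExpr.cost]
    omega
  · rw [hX]
    exact subset_convexHull ℝ _ hV.isGrowth_trace.toMatrix_mem
  · rw [hX]
    exact hV.isMaxOn hD

end RealRAM

/-- Linear optimization over the partitioning orbitope can be solved in time `O(pq)`: a single
program, given `p ≥ q ≥ 1` and any `d`, computes an optimal solution of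
`max {⟨d, x⟩ | x ∈ partitioningOrbitope p q}` within `C * (p * q)` steps. -/
theorem corollary3p7 :
    ∃ (P : RealRAM.Program) (C : ℕ), ∀ (p q : ℕ), 1 ≤ q → q ≤ p →
      ∀ d : Matrix (Fin p) (Fin q) ℝ,
        ∃ (T : ℕ) (s : RealRAM.State),
          RealRAM.Exec P (RealRAM.inputState p q d) T s ∧
          T ≤ C * (p * q) ∧
          RealRAM.outputMatrix p q s ∈ partitioningOrbitope p q ∧
          IsMaxOn (objective d) (partitioningOrbitope p q) (RealRAM.outputMatrix p q s) :=
  ⟨RealRAM.orbitopeProgram, 200, fun _ _ hq hqp d =>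
    RealRAM.halts_orbitopeProgram hq (hq.trans hqp) d⟩
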